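/- Let $T\subset\mathbb{R}^3$ be a (nondegenerate) tetrahedron and let $F\subset\partial T$ be one of its four faces; write $|T|$ for the volume of $T$ and $|F|$ for the area of $F$. For an integer $m\ge 0$ let $\mathbb{P}_m(T)$ be the space of real polynomials of total degree at most $m$ on $T$, and let $\Pi_T^m$ be the $L^2(T)$-orthogonal projection onto $\mathbb{P}_m(T)$; set $\Pi_T^{-1}:=0$. Let $p\ge 0$ and $-1\le n\le p$ be integers. Then for every $\xi\in\mathbb{P}_p(T)$, the polynomial $\theta:=\xi-\Pi_T^n\xi$ satisfies $$\|\theta\|_{L^2(F)}^2\;\le\;\frac{(p-n)(p+n+4)}{3}\,\frac{|F|}{|T|}\,\|\theta\|_{L^2(T)}^2 .$$ -/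

import Mathlib

open MeasureTheory

noncomputable section

/-- A (nondegenerate) tetrahedron in Euclidean 3-space, given by four affinely independent
vertices. As a point set it is `T.closedInterior`, and its four (triangular) faces are the sets
`(T.faceOpposite i).closedInterior`. -/
abbrev Tetrahedron : Type := Affine.Simplex ℝ (EuclideanSpace ℝ (Fin 3)) 3

/-- The polynomials of total degree at most `n`; this is the zero space for `n = -1`. -/
def polySpace : ℤ → Submodule ℝ (MvPolynomial (Fin 3) ℝ)
  | Int.ofNat n => MvPolynomial.restrictTotalDegree (Fin 3) ℝ n
  | Int.negSucc _ => ⊥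

/-- The function on Euclidean 3-space defined by a polynomial. -/
def polyFun (P : MvPolynomial (Fin 3) ℝ) (x : EuclideanSpace ℝ (Fin 3)) : ℝ :=
  MvPolynomial.eval (fun j => x j) P

/-- `η` is the `L²(T)`-orthogonal projection of `ξ` onto the polynomials of degree at most `n`. -/
def IsL2Projection (T : Tetrahedron) (n : ℤ) (ξ η : MvPolynomial (Fin 3) ℝ) : Prop :=
  η ∈ polySpace n ∧
    ∀ v ∈ polySpace n, ∫ x in T.closedInterior, (polyFun ξ x - polyFun η x) * polyFun v x = 0

theorem continuous_polyFun (P : MvPolynomial (Fin 3) ℝ) : Continuous (polyFun P) := by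
  unfold polyFun
  exact P.continuous_eval.comp (by fun_prop)

theorem isCompact_tetrahedron (T : Tetrahedron) : IsCompact T.closedInterior := by
  rw [← T.convexHull_eq_closedInterior]
  exact (Set.finite_range _).isCompact_convexHull ℝ

theorem nonempty_interior_tetrahedron (T : Tetrahedron) :
    (interior T.closedInterior).Nonempty := by
  rw [← T.convexHull_eq_closedInterior, interior_convexHull_nonempty_iff_affineSpan_eq_top]
  exact T.independent.affineSpan_eq_top_iff_card_eq_finrank_add_one.mpr (by simp)

theorem integrableOn_polyFun_mul (T : Tetrahedron) (P Q : MvPolynomial (Fin 3) ℝ) :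
    IntegrableOn (fun x => polyFun P x * polyFun Q x) T.closedInterior :=
  ((continuous_polyFun P).mul (continuous_polyFun Q)).continuousOn.integrableOn_compact
    (isCompact_tetrahedron T)

/-- The `L²(T)` inner product of two polynomials, as a bilinear map. -/
def l2Form (T : Tetrahedron) :
    MvPolynomial (Fin 3) ℝ →ₗ[ℝ] MvPolynomial (Fin 3) ℝ →ₗ[ℝ] ℝ :=
  LinearMap.mk₂ ℝ (fun P Q => ∫ x in T.closedInterior, polyFun P x * polyFun Q x)
    (fun P P' Q => by
      rw [← integral_add (integrableOn_polyFun_mul T P Q) (integrableOn_polyFun_mul T P' Q)]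
      simp [polyFun, add_mul])
    (fun c P Q => by
      rw [smul_eq_mul, ← integral_const_mul]
      simp [polyFun, mul_assoc])
    (fun P Q Q' => by
      rw [← integral_add (integrableOn_polyFun_mul T P Q) (integrableOn_polyFun_mul T P Q')]
      simp [polyFun, mul_add])
    (fun c P Q => by
      rw [smul_eq_mul, ← integral_const_mul]
      simp [polyFun, mul_left_comm])

theorem l2Form_apply (T : Tetrahedron) (P Q : MvPolynomial (Fin 3) ℝ) :
    l2Form T P Q = ∫ x in T.closedInterior, polyFun P x * polyFun Q x := rfl

theorem eq_zero_of_l2Form_self (T : Tetrahedron) (P : MvPolynomial (Fin 3) ℝ)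
    (h : l2Form T P P = 0) : P = 0 := by
  rw [l2Form_apply] at h
  have hint := integrableOn_polyFun_mul T P P
  rw [setIntegral_eq_zero_iff_of_nonneg_ae
    (Filter.Eventually.of_forall fun x => mul_self_nonneg _) hint] at h
  have h1 : (fun x => polyFun P x * polyFun P x)
      =ᵐ[volume.restrict (interior T.closedInterior)] fun _ => 0 :=
    ae_restrict_of_ae_restrict_of_subset interior_subset h
  have h2 := Measure.eqOn_open_of_ae_eq h1 isOpen_interior
    ((continuous_polyFun P).mul (continuous_polyFun P)).continuousOn continuousOn_const
  obtain ⟨x₀, hx₀⟩ := nonempty_interior_tetrahedron T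
  let e := EuclideanSpace.equiv (Fin 3) ℝ
  have hopen : IsOpen (e.symm ⁻¹' interior T.closedInterior) :=
    isOpen_interior.preimage e.symm.continuous
  obtain ⟨ε, hε, hball⟩ := Metric.isOpen_iff.mp hopen (e x₀) (by simpa using hx₀)
  refine MvPolynomial.funext_set (fun i => Metric.ball (e x₀ i) ε) (fun i => ?_) ?_
  · exact infinite_of_mem_nhds _ (Metric.ball_mem_nhds _ hε)
  · intro y hy
    have hy' : y ∈ Metric.ball (e x₀) ε := by
      rw [Metric.mem_ball, dist_pi_lt_iff hε]
      exact fun i => hy i (Set.mem_univ i)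
    have := h2 (hball hy')
    have h3 : polyFun P (e.symm y) = 0 := by simpa using this
    simpa [polyFun, e] using h3

instance finite_polySpace (n : ℤ) : Module.Finite ℝ (polySpace n) := by
  cases n with
  | ofNat n =>
    change Module.Finite ℝ (MvPolynomial.restrictTotalDegree (Fin 3) ℝ n)
    infer_instance
  | negSucc n =>
    change Module.Finite ℝ (⊥ : Submodule ℝ (MvPolynomial (Fin 3) ℝ))
    infer_instance

theorem isL2Projection_iff (T : Tetrahedron) (n : ℤ) (ξ η : MvPolynomial (Fin 3) ℝ) :
    IsL2Projection T n ξ η ↔ η ∈ polySpace n ∧ ∀ v ∈ polySpace n, l2Form T (ξ - η) v = 0 := by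
  simp only [IsL2Projection, l2Form_apply, polyFun, MvPolynomial.eval_sub]

/-- The `L²(T)`-projection exists and is unique. -/
theorem existsUnique_isL2Projection (T : Tetrahedron) (n : ℤ) (ξ : MvPolynomial (Fin 3) ℝ) :
    ∃! η, IsL2Projection T n ξ η := by
  simp only [isL2Projection_iff]
  let B : polySpace n →ₗ[ℝ] Module.Dual ℝ (polySpace n) :=
    (l2Form T).domRestrict₁₂ (polySpace n) (polySpace n)
  have hB : Function.Injective B := by
    rw [← LinearMap.ker_eq_bot, LinearMap.ker_eq_bot']
    intro v hv
    have : l2Form T v v = 0 := LinearMap.congr_fun hv v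
    exact Subtype.ext (eq_zero_of_l2Form_self T v this)
  have hs : Function.Surjective B :=
    (LinearMap.injective_iff_surjective_of_finrank_eq_finrank
      Subspace.dual_finrank_eq.symm).mp hB
  obtain ⟨η, hη⟩ := hs ((l2Form T ξ).domRestrict (polySpace n))
  refine ⟨η, ⟨η.2, fun v hv => ?_⟩, ?_⟩
  · have : l2Form T η v = l2Form T ξ v := LinearMap.congr_fun hη ⟨v, hv⟩
    rw [map_sub, LinearMap.sub_apply, this, sub_self]
  · rintro η' ⟨h1, h2⟩
    have : B ⟨η', h1⟩ = B η := by
      rw [hη]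
      ext v
      have := h2 v v.2
      rw [map_sub, LinearMap.sub_apply, sub_eq_zero] at this
      exact this.symm
    exact congrArg Subtype.val (hB this)

/-- The `L²(T)`-orthogonal projection `Π_T^n` onto polynomials of degree at most `n`
(with `Π_T^{-1} = 0`). -/
def l2Projection (T : Tetrahedron) (n : ℤ) (ξ : MvPolynomial (Fin 3) ℝ) :
    MvPolynomial (Fin 3) ℝ :=
  (existsUnique_isL2Projection T n ξ).choose

theorem l2Projection_spec (T : Tetrahedron) (n : ℤ) (ξ : MvPolynomial (Fin 3) ℝ) :
    IsL2Projection T n ξ (l2Projection T n ξ) :=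
  (existsUnique_isL2Projection T n ξ).choose_spec.1

end

/-! Let `v` be the vertex opposite the face `F`, and `c = 3|T|/|F|` the height. The field `(x - v)
P²` has no flux through the faces containing `v`, and its normal component on `F` is `c P²`. Its
divergence is `3P² + 2P·EP`, with `E = (x - v)·∇`. If `P` has degree at most `m` and is orthogonal
to all lower degrees, then `EP - mP` has degree below `m`, so `c‖P‖²_F = (2m + 3)‖P‖²_T`
(`exists_height`). The divergence theorem is replaced by integration along rays from `v`
(`integral_ray_euler`, `exists_cone_parametrization`).

Split `θ` into such components for `m = n+1, …, p`. They are orthogonal on `T` but not on `F`;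
Cauchy–Schwarz with weights `2m + 3` yields the constant `∑ (2m + 3) = (p - n)(p + n + 4)`, divided
by `c`. `face_integral_le` does this one degree at a time. -/

theorem mem_polySpace_iff {n : ℤ} {P : MvPolynomial (Fin 3) ℝ} :
    P ∈ polySpace n ↔ ∀ d ∈ P.support, (d.degree : ℤ) ≤ n := by
  cases n with
  | ofNat n =>
    change P ∈ MvPolynomial.restrictTotalDegree (Fin 3) ℝ n ↔ _
    rw [MvPolynomial.mem_restrictTotalDegree, MvPolynomial.totalDegree, Finset.sup_le_iff]
    simp only [Finsupp.degree_eq_sum, Finsupp.sum_fintype, implies_true, Int.ofNat_eq_natCast,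
      Nat.cast_le]
  | negSucc n =>
    change P ∈ (⊥ : Submodule ℝ (MvPolynomial (Fin 3) ℝ)) ↔ _
    rw [Submodule.mem_bot]
    refine ⟨fun h => by simp [h], fun h => ?_⟩
    rw [← MvPolynomial.support_eq_empty, Finset.eq_empty_iff_forall_notMem]
    intro d hd
    have := h d hd
    omega

theorem polySpace_mono {m n : ℤ} (h : m ≤ n) : polySpace m ≤ polySpace n := fun _ hP =>
  mem_polySpace_iff.2 fun d hd => (mem_polySpace_iff.1 hP d hd).trans h

theorem monomial_mem_polySpace {n : ℤ} {d : Fin 3 →₀ ℕ} (h : (d.degree : ℤ) ≤ n) (a : ℝ) :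
    MvPolynomial.monomial d a ∈ polySpace n :=
  mem_polySpace_iff.2 fun e he => by
    rw [Finset.mem_singleton.1 (MvPolynomial.support_monomial_subset he)]
    exact h

/-! ### Euler operator and radial derivatives -/

/-- The Euler operator `(x - v) · ∇` centred at `v`. -/
noncomputable def eulerOperator (v : Fin 3 → ℝ) :
    MvPolynomial (Fin 3) ℝ →ₗ[ℝ] MvPolynomial (Fin 3) ℝ :=
  ∑ j, LinearMap.mulLeft ℝ (MvPolynomial.X j - MvPolynomial.C (v j)) ∘ₗ
    (MvPolynomial.pderiv j).toLinearMap

theorem eulerOperator_apply (v : Fin 3 → ℝ) (P : MvPolynomial (Fin 3) ℝ) :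
    eulerOperator v P =
      ∑ j, (MvPolynomial.X j - MvPolynomial.C (v j)) * MvPolynomial.pderiv j P := by
  simp [eulerOperator]

theorem C_mul_pderiv_monomial_mem_polySpace {m : ℤ} (d : Fin 3 →₀ ℕ) (hd : (d.degree : ℤ) ≤ m)
    (a b : ℝ) (j : Fin 3) :
    MvPolynomial.C b * MvPolynomial.pderiv j (MvPolynomial.monomial d a) ∈ polySpace (m - 1) := by
  rw [MvPolynomial.pderiv_monomial, MvPolynomial.C_mul_monomial]
  rcases Nat.eq_zero_or_pos (d j) with h | h
  · simp [h]
  · refine monomial_mem_polySpace ?_ _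
    have hle : Finsupp.single j 1 ≤ d := by simpa [Nat.one_le_iff_ne_zero] using h.ne'
    have := congrArg Finsupp.degree (tsub_add_cancel_of_le hle)
    rw [map_add, Finsupp.degree_single] at this
    omega

/-- On polynomials of degree at most `m`, the Euler operator is multiplication by `m` up to terms
of lower degree. -/
theorem eulerOperator_sub_smul_mem (v : Fin 3 → ℝ) {m : ℤ} {P : MvPolynomial (Fin 3) ℝ}
    (hP : P ∈ polySpace m) : eulerOperator v P - (m : ℝ) • P ∈ polySpace (m - 1) := by
  rw [mem_polySpace_iff] at hP
  suffices h : ∀ d : Fin 3 →₀ ℕ, (d.degree : ℤ) ≤ m → ∀ a : ℝ,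
      eulerOperator v (MvPolynomial.monomial d a) - (m : ℝ) • MvPolynomial.monomial d a ∈
        polySpace (m - 1) by
    rw [P.as_sum, map_sum, Finset.smul_sum, ← Finset.sum_sub_distrib]
    exact Submodule.sum_mem _ fun d hd => h d (hP d hd) _
  intro d hd a
  -- Euler's identity for homogeneous polynomials; shifting the centre to `v` only adds first
  -- derivatives, which lower the degree.
  have hE : eulerOperator v (MvPolynomial.monomial d a) =
      (d.degree : ℝ) • MvPolynomial.monomial d a -
        ∑ j, MvPolynomial.C (v j) * MvPolynomial.pderiv j (MvPolynomial.monomial d a) := by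
    simp only [eulerOperator_apply, sub_mul, Finset.sum_sub_distrib]
    congr 1
    have := (MvPolynomial.isHomogeneous_monomial a (rfl : d.degree = d.degree)).sum_X_mul_pderiv
    rw [this, Nat.cast_smul_eq_nsmul]
  rw [hE, sub_right_comm, ← sub_smul]
  refine Submodule.sub_mem _ ?_ (Submodule.sum_mem _ fun j _ =>
    C_mul_pderiv_monomial_mem_polySpace d hd a _ j)
  -- In top degree the coefficient `d.degree - m` vanishes; otherwise the monomial itself has lower
  -- degree.
  rcases hd.eq_or_lt with h | h
  · rw [← h]; simp
  · exact Submodule.smul_mem _ _ (monomial_mem_polySpace (by omega) _)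

theorem hasDerivAt_eval_add_smul (P : MvPolynomial (Fin 3) ℝ) (v w : Fin 3 → ℝ) (s : ℝ) :
    HasDerivAt (fun s : ℝ => MvPolynomial.eval (fun j => v j + s * w j) P)
      (∑ j, w j * MvPolynomial.eval (fun j => v j + s * w j) (MvPolynomial.pderiv j P)) s := by
  induction P using MvPolynomial.induction_on with
  | C a => simpa using hasDerivAt_const s a
  | add P Q hP hQ =>
    simp only [map_add, mul_add, Finset.sum_add_distrib]
    exact hP.add hQ
  | mul_X P i hP =>
    have hX : HasDerivAt (fun s : ℝ => v i + s * w i) (w i) s := by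
      simpa using ((hasDerivAt_id s).mul_const (w i)).const_add (v i)
    simp only [map_mul, MvPolynomial.eval_X]
    refine (hP.mul hX).congr_deriv ?_
    simp only [Derivation.leibniz, MvPolynomial.pderiv_X, smul_eq_mul, map_add, map_mul,
      MvPolynomial.eval_X, mul_add (w _), Finset.sum_add_distrib, Finset.sum_mul]
    rw [add_comm]
    congr 1
    · rw [Finset.sum_eq_single i]
      · simp [mul_comm]
      · intro j _ hj
        simp [hj]
      · simp
    · exact Finset.sum_congr rfl fun j _ => by ring

theorem hasDerivAt_polyFun_add_smul (P : MvPolynomial (Fin 3) ℝ)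
    (v w : EuclideanSpace ℝ (Fin 3)) (s : ℝ) :
    HasDerivAt (fun s : ℝ => polyFun P (v + s • w))
      (∑ j, w j * polyFun (MvPolynomial.pderiv j P) (v + s • w)) s := by
  simpa [polyFun] using hasDerivAt_eval_add_smul P (fun j => v j) (fun j => w j) s

/-- Integration along the segment from `v` to `v + w` of the divergence of `(x - v) P ^ 2`. -/
theorem integral_ray_euler (P : MvPolynomial (Fin 3) ℝ) (v w : EuclideanSpace ℝ (Fin 3)) :
    ∫ s in (0 : ℝ)..1, s ^ 2 * (3 * (polyFun P (v + s • w) * polyFun P (v + s • w)) +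
      2 * (polyFun P (v + s • w) * polyFun (eulerOperator (fun j => v j) P) (v + s • w))) =
      polyFun P (v + w) * polyFun P (v + w) := by
  have hc (Q : MvPolynomial (Fin 3) ℝ) : Continuous fun s : ℝ => polyFun Q (v + s • w) :=
    (continuous_polyFun Q).comp (by fun_prop)
  -- Along the ray the Euler operator is `s · d/ds`, so `s ^ 3 * P ^ 2` is a primitive; the factor
  -- `s ^ 2` is the cone's Jacobian.
  have hd (s : ℝ) : HasDerivAt (fun s : ℝ => s ^ 3 * polyFun P (v + s • w) ^ 2)
      (s ^ 2 * (3 * (polyFun P (v + s • w) * polyFun P (v + s • w)) +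
      2 * (polyFun P (v + s • w) * polyFun (eulerOperator (fun j => v j) P) (v + s • w)))) s := by
    refine ((hasDerivAt_pow 3 s).mul ((hasDerivAt_polyFun_add_smul P v w s).pow 2)).congr_deriv ?_
    have : polyFun (eulerOperator (fun j => v j) P) (v + s • w) =
        s * ∑ j, w j * polyFun (MvPolynomial.pderiv j P) (v + s • w) := by
      simp [eulerOperator_apply, polyFun, Finset.mul_sum, mul_assoc]
    rw [this]
    norm_num
    ring
  rw [intervalIntegral.integral_eq_sub_of_hasDerivAt (fun s _ => hd s)
    (by
      have h1 := hc P
      have h2 := hc (eulerOperator (fun j => v j) P)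
      exact Continuous.intervalIntegrable (by fun_prop) _ _)]
  simp [sq]

/-! ### Integration over cones -/

section Cone

open scoped Pointwise

variable {V E : Type*} [NormedAddCommGroup V] [NormedSpace ℝ V] [FiniteDimensional ℝ V]
  [MeasurableSpace V] [BorelSpace V] [NormedAddCommGroup E] [NormedSpace ℝ E]
  [FiniteDimensional ℝ E] [MeasurableSpace E] [BorelSpace E]

/-- The cone over a compact base `K`, in coordinates `(s, z)` with apex at the origin. -/
theorem setIntegral_cone_prod (μ : Measure V) [μ.IsAddHaarMeasure] {K : Set V} (hK : IsCompact K)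
    {S : Set (ℝ × V)} (hS : S = (fun p : ℝ × V => (p.1, p.1 • p.2)) '' (Set.Icc 0 1 ×ˢ K))
    {g : ℝ × V → ℝ} (hg : Continuous g) :
    ∫ p in S, g p ∂(volume.prod μ) =
      ∫ y in K, (∫ s in (0 : ℝ)..1, s ^ Module.finrank ℝ V * g (s, s • y)) ∂μ := by
  have hSc : IsCompact S := by
    rw [hS]
    exact (isCompact_Icc.prod hK).image (by fun_prop)
  have hmem (s : ℝ) (z : V) : (s, z) ∈ S ↔ s ∈ Set.Icc (0 : ℝ) 1 ∧ z ∈ s • K := by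
    rw [hS]
    constructor
    · rintro ⟨⟨a, y⟩, ⟨ha, hy⟩, h⟩
      obtain ⟨rfl, rfl⟩ := Prod.mk.inj h
      exact ⟨ha, y, hy, rfl⟩
    · rintro ⟨hs, y, hy, rfl⟩
      exact ⟨(s, y), ⟨hs, hy⟩, rfl⟩
  have hint : Integrable (S.indicator g) (volume.prod μ) :=
    (integrable_indicator_iff hSc.measurableSet).2 (hg.continuousOn.integrableOn_compact hSc)
  rw [← integral_indicator hSc.measurableSet, integral_prod _ hint]
  -- The slice at height `s` is `s • K`; substituting `z = s • y` produces the power of `s`. The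
  -- substitution degenerates at `s = 0`, a null set.
  have hfib (s : ℝ) (hs : s ≠ 0) : ∫ z, S.indicator g (s, z) ∂μ =
      (Set.Ioc (0 : ℝ) 1).indicator
        (fun s => ∫ y in K, s ^ Module.finrank ℝ V * g (s, s • y) ∂μ) s := by
    by_cases h : s ∈ Set.Ioc (0 : ℝ) 1
    · have h0 : (fun z => S.indicator g (s, z)) = (s • K).indicator fun z => g (s, z) := by
        ext z
        have hz : (s, z) ∈ S ↔ z ∈ s • K := by simp [hmem, h.1.le, h.2]
        by_cases hzK : z ∈ s • K
        · rw [Set.indicator_of_mem (hz.2 hzK), Set.indicator_of_mem hzK]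
        · rw [Set.indicator_of_notMem (mt hz.1 hzK), Set.indicator_of_notMem hzK]
      rw [h0, integral_indicator (hK.smul s).measurableSet, Set.indicator_of_mem h,
        integral_const_mul, Measure.setIntegral_comp_smul_of_pos μ (fun z => g (s, z)) K h.1,
        smul_eq_mul, mul_inv_cancel_left₀ (pow_ne_zero _ hs)]
    · have h0 : (fun z => S.indicator g (s, z)) = 0 := by
        ext z
        refine Set.indicator_of_notMem (fun hz => h ?_) _
        have := ((hmem s z).1 hz).1
        exact ⟨lt_of_le_of_ne this.1 hs.symm, this.2⟩
      rw [h0, Set.indicator_of_notMem h]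
      simp
  rw [integral_congr_ae (g := (Set.Ioc (0 : ℝ) 1).indicator
        (fun s => ∫ y in K, s ^ Module.finrank ℝ V * g (s, s • y) ∂μ)),
    integral_indicator measurableSet_Ioc, integral_integral_swap]
  · simp only [intervalIntegral.integral_of_le zero_le_one]
  · rw [Measure.prod_restrict]
    refine IntegrableOn.mono_set ?_ (Set.prod_mono_left (t := K) Set.Ioc_subset_Icc_self)
    refine ContinuousOn.integrableOn_compact (isCompact_Icc.prod hK) (Continuous.continuousOn ?_)
    simp only [Function.uncurry_def]
    fun_prop
  · filter_upwards [Measure.ae_ne volume (0 : ℝ)] with s hs using hfib s hs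

/-- The cone with apex `v` over a compact base `K` in a hyperplane. -/
theorem exists_setIntegral_cone (μ : Measure V) [μ.IsAddHaarMeasure] (ν : Measure E)
    [ν.IsAddHaarMeasure] (Ψ : (ℝ × V) ≃L[ℝ] E) (v : E) {K : Set V} (hK : IsCompact K)
    {T : Set E} (hT : T = (fun p : ℝ × V => v + p.1 • Ψ (1, p.2)) '' (Set.Icc 0 1 ×ˢ K)) :
    ∃ c : ℝ, 0 < c ∧ ∀ f : E → ℝ, Continuous f → ∫ x in T, f x ∂ν =
      c * ∫ y in K, (∫ s in (0 : ℝ)..1,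
        s ^ Module.finrank ℝ V * f (v + s • Ψ (1, y))) ∂μ := by
  -- Uniqueness of Haar measure gives the constant without computing a determinant.
  let ρ : Measure E := (volume.prod μ).map Ψ
  have hρ : ρ.IsAddHaarMeasure := Ψ.isAddHaarMeasure_map _
  refine ⟨ν.addHaarScalarFactor ρ, by
    exact_mod_cast Measure.addHaarScalarFactor_pos_of_isAddHaarMeasure ν ρ, fun f hf => ?_⟩
  let e : (ℝ × V) ≃ₜ E := Ψ.toHomeomorph.trans (Homeomorph.addLeft v)
  have he (p : ℝ × V) : e p = v + Ψ p := rfl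
  have hmap : (volume.prod μ).map e = ρ := by
    rw [← map_add_left_eq_self ρ v, Measure.map_map (by fun_prop) (by fun_prop)]
    rfl
  conv_lhs => rw [Measure.isAddLeftInvariant_eq_smul ν ρ]
  rw [Measure.restrict_smul, integral_smul_nnreal_measure, NNReal.smul_def, smul_eq_mul]
  congr 1
  rw [← hmap, e.measurableEmbedding.setIntegral_map, setIntegral_cone_prod μ hK _
      (g := fun p => f (e p)) (hf.comp e.continuous)]
  · have hΨ (s : ℝ) (y : V) : e (s, s • y) = v + s • Ψ (1, y) := by
      rw [he, ← map_smul]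
      simp
    simp only [hΨ]
  · rw [hT]
    apply e.injective.image_injective
    rw [e.image_preimage, Set.image_image]
    refine Set.image_congr fun p _ => ?_
    rw [he, ← map_smul]
    simp

end Cone

theorem closedInterior_eq_cone (T : Tetrahedron) (i : Fin 4) :
    T.closedInterior = (fun p : ℝ × EuclideanSpace ℝ (Fin 3) =>
      T.points i + p.1 • (p.2 - T.points i)) ''
        (Set.Icc 0 1 ×ˢ (T.faceOpposite i).closedInterior) := by
  have hr : Set.range T.points =
      insert (T.points i) (Set.range (T.faceOpposite i).points) := by
    rw [Affine.Simplex.range_faceOpposite_points, ← Set.image_insert_eq, ← Set.image_univ]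
    congr 1
    ext j
    simp [em]
  rw [← T.convexHull_eq_closedInterior, ← (T.faceOpposite i).convexHull_eq_closedInterior, hr,
    convexHull_insert (Set.range_nonempty _)]
  ext x
  simp only [mem_convexJoin, Set.mem_singleton_iff, exists_eq_left, segment_eq_image',
    Set.mem_image, Set.mem_prod, Prod.exists]
  constructor
  · rintro ⟨y, hy, s, hs, rfl⟩
    exact ⟨s, y, ⟨hs, hy⟩, rfl⟩
  · rintro ⟨s, y, ⟨hs, hy⟩, rfl⟩
    exact ⟨y, hy, s, hs, rfl⟩

/-- A tetrahedron is a cone over any of its faces: there is an isometric parametrization of the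
plane of the face, and the volume integral is an iterated integral along the rays from the opposite
vertex. -/
theorem exists_cone_parametrization (T : Tetrahedron) (i : Fin 4) :
    ∃ (c : ℝ) (b : EuclideanSpace ℝ (Fin 2) → EuclideanSpace ℝ (Fin 3))
      (K : Set (EuclideanSpace ℝ (Fin 2))), 0 < c ∧ Isometry b ∧ IsCompact K ∧
      (μHE[2] : Measure (EuclideanSpace ℝ (Fin 3))).restrict (T.faceOpposite i).closedInterior =
        (volume.restrict K).map b ∧
      ∀ f : EuclideanSpace ℝ (Fin 3) → ℝ, Continuous f → ∫ x in T.closedInterior, f x =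
        c * ∫ y in K, ∫ s in (0 : ℝ)..1,
          s ^ 2 * f (T.points i + s • (b y - T.points i)) := by
  set v := T.points i with hv
  set F := (T.faceOpposite i).closedInterior with hF
  let A := affineSpan ℝ (Set.range (T.faceOpposite i).points)
  have hfin : Module.finrank ℝ A.direction = 2 := by
    rw [direction_affineSpan]
    exact (T.faceOpposite i).independent.finrank_vectorSpan (by simp)
  let q := (T.faceOpposite i).points 0
  have hq : q ∈ A := mem_affineSpan ℝ ⟨0, rfl⟩
  let o : EuclideanSpace ℝ (Fin 2) ≃ₗᵢ[ℝ] A.direction :=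
    ((stdOrthonormalBasis ℝ A.direction).reindex (finCongr hfin)).repr.symm
  let L : EuclideanSpace ℝ (Fin 2) →ₗᵢ[ℝ] EuclideanSpace ℝ (Fin 3) :=
    A.direction.subtypeₗᵢ.comp o.toLinearIsometry
  let b : EuclideanSpace ℝ (Fin 2) → EuclideanSpace ℝ (Fin 3) := fun z => q + L z
  have hLr (x : EuclideanSpace ℝ (Fin 3)) : x ∈ A.direction ↔ ∃ z, L z = x := by
    refine ⟨fun h => ⟨o.symm ⟨x, h⟩, by simp [L]⟩, ?_⟩
    rintro ⟨z, rfl⟩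
    exact (o z).2
  have hbr : Set.range b = A := by
    ext x
    rw [SetLike.mem_coe, ← AffineSubspace.vsub_right_mem_direction_iff_mem hq, hLr]
    simp [b, eq_sub_iff_add_eq']
  have hb : Isometry b := (isometry_add_left q).comp L.isometry
  have hFA : F ⊆ Set.range b := by
    rw [hbr]
    exact (T.faceOpposite i).closedInterior_subset_affineSpan
  have hFc : IsCompact F := (T.faceOpposite i).isCompact_closedInterior
  have hbe : Topology.IsClosedEmbedding b := hb.isClosedEmbedding
  have hK : IsCompact (b ⁻¹' F) := hbe.isCompact_preimage hFc
  have hvA : v ∉ A := T.points_notMem_affineSpan_faceOpposite i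
  -- Injective because `v` lies off the plane of the face: a kernel element with `s ≠ 0` would put
  -- `v - q` in its direction.
  let Φ : (ℝ × EuclideanSpace ℝ (Fin 2)) →ₗ[ℝ] EuclideanSpace ℝ (Fin 3) :=
    (LinearMap.toSpanSingleton ℝ _ (q - v)).coprod L.toLinearMap
  have hΦ (s : ℝ) (z : EuclideanSpace ℝ (Fin 2)) : Φ (s, z) = s • (q - v) + L z := by
    simp [Φ]
  have hΦi : Function.Injective Φ := by
    rw [← LinearMap.ker_eq_bot, LinearMap.ker_eq_bot']
    rintro ⟨s, z⟩ h
    rw [hΦ] at h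
    have hs : s = 0 := by
      by_contra hs
      refine hvA ((AffineSubspace.vsub_right_mem_direction_iff_mem hq v).1 ((hLr _).2
        ⟨s⁻¹ • z, ?_⟩))
      have h2 : L z = s • (v - q) := by
        rw [← sub_eq_zero, ← h]
        module
      rw [map_smul, h2, smul_smul, inv_mul_cancel₀ hs, one_smul, vsub_eq_sub]
    subst hs
    have h0 : L z = 0 := by simpa using h
    rw [L.injective (h0.trans (map_zero L).symm), Prod.mk_zero_zero]
  let Ψ : (ℝ × EuclideanSpace ℝ (Fin 2)) ≃L[ℝ] EuclideanSpace ℝ (Fin 3) :=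
    (Φ.linearEquivOfInjective hΦi (by simp)).toContinuousLinearEquiv
  have hΨ (y : EuclideanSpace ℝ (Fin 2)) : Ψ (1, y) = b y - v := by
    change Φ (1, y) = _
    rw [hΦ, one_smul]
    simp only [b]
    abel
  obtain ⟨c, hc, hcone⟩ := exists_setIntegral_cone volume volume Ψ v hK (T := T.closedInterior) (by
    rw [closedInterior_eq_cone T i, ← hv, ← hF]
    simp only [hΨ]
    conv_lhs => rw [← Set.image_preimage_eq_of_subset hFA]
    ext x
    simp only [Set.mem_image, Set.mem_prod, Prod.exists]
    constructor
    · rintro ⟨s, _, ⟨hs, y, hy, rfl⟩, rfl⟩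
      exact ⟨s, y, ⟨hs, hy⟩, rfl⟩
    · rintro ⟨s, y, ⟨hs, hy⟩, rfl⟩
      exact ⟨s, b y, ⟨hs, y, hy, rfl⟩, rfl⟩)
  refine ⟨c, b, b ⁻¹' F, hc, hb, hK, ?_, ?_⟩
  · rw [← Measure.restrict_map hbe.measurableEmbedding.measurable hFc.measurableSet,
      ← EuclideanSpace.euclideanHausdorffMeasure_eq_volume, hb.map_euclideanHausdorffMeasure,
      Measure.restrict_restrict hFc.measurableSet, Set.inter_eq_left.2 hFA]
  · simpa [hΨ] using hcone

theorem l2Form_comm (T : Tetrahedron) (P Q : MvPolynomial (Fin 3) ℝ) :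
    l2Form T P Q = l2Form T Q P := by
  simp only [l2Form_apply, mul_comm]

/-! ### Trace identity and trace inequality -/

/-- The surface measure on the face of `T` opposite to the vertex `i`. -/
noncomputable def faceMeasure (T : Tetrahedron) (i : Fin 4) :
    Measure (EuclideanSpace ℝ (Fin 3)) :=
  (μHE[2]).restrict (T.faceOpposite i).closedInterior

/-- The constant `c` is the height `3 |T| / |F|`. For a polynomial of degree `m` orthogonal to all
polynomials of lower degree, the norms on the face and on the tetrahedron are proportional. -/
theorem exists_height (T : Tetrahedron) (i : Fin 4) :
    ∃ c : ℝ, 0 < c ∧ IsFiniteMeasure (faceMeasure T i) ∧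
      3 * volume.real T.closedInterior = c * (faceMeasure T i).real Set.univ ∧
      (∀ f : EuclideanSpace ℝ (Fin 3) → ℝ, Continuous f → Integrable f (faceMeasure T i)) ∧
      ∀ (m : ℤ) (P : MvPolynomial (Fin 3) ℝ), P ∈ polySpace m →
        (∀ Q ∈ polySpace (m - 1), l2Form T P Q = 0) →
        c * ∫ x, polyFun P x * polyFun P x ∂(faceMeasure T i) = (2 * m + 3) * l2Form T P P := by
  obtain ⟨c, b, K, hc, hb, hK, hF, hcone⟩ := exists_cone_parametrization T i
  have hbm : MeasurableEmbedding b := hb.isClosedEmbedding.measurableEmbedding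
  have hfin : IsFiniteMeasure (volume.restrict K) := ⟨by simpa using hK.measure_lt_top⟩
  rw [← faceMeasure] at hF
  refine ⟨c, hc, ?_, ?_, ?_, ?_⟩
  · rw [hF]
    infer_instance
  · have h1 := hcone (fun _ => 1) continuous_const
    have h2 : ∫ s in (0 : ℝ)..1, s ^ 2 * (1 : ℝ) = 1 / 3 := by
      simp only [mul_one, integral_pow]
      norm_num
    simp only [h2, setIntegral_const, smul_eq_mul] at h1
    rw [hF, map_measureReal_apply hbm.measurable MeasurableSet.univ, Set.preimage_univ,
      measureReal_restrict_apply_univ]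
    linarith
  · intro f hf
    rw [hF, hbm.integrable_map_iff]
    exact (hf.comp hb.continuous).continuousOn.integrableOn_compact hK
  · intro m P hP horth
    have h1 := hcone (fun x => 3 * (polyFun P x * polyFun P x) +
      2 * (polyFun P x * polyFun (eulerOperator (fun j => T.points i j) P) x)) (by
        have := continuous_polyFun P
        have := continuous_polyFun (eulerOperator (fun j => T.points i j) P)
        fun_prop)
    simp only [integral_ray_euler, add_sub_cancel] at h1
    rw [hF, hbm.integral_map, ← h1,
      integral_add ((integrableOn_polyFun_mul T _ _).const_mul _)
        ((integrableOn_polyFun_mul T _ _).const_mul _), integral_const_mul, integral_const_mul,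
      ← l2Form_apply, ← l2Form_apply]
    have h2 := horth _ (eulerOperator_sub_smul_mem (fun j => T.points i j) hP)
    rw [map_sub, map_smul, smul_eq_mul] at h2
    linarith

theorem eq_zero_of_mem_of_orthogonal (T : Tetrahedron) {n : ℤ} {P : MvPolynomial (Fin 3) ℝ}
    (hP : P ∈ polySpace n) (horth : ∀ Q ∈ polySpace n, l2Form T P Q = 0) : P = 0 :=
  eq_zero_of_l2Form_self T P (horth P hP)

/-- Two-term Cauchy–Schwarz with weights `N` and `M`; the defect is a perfect square over `N * M`.
-/
theorem add_mul_self_le_of_pos {x y N M : ℝ} (hN : 0 < N) (hM : 0 < M) :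
    (x + y) * (x + y) ≤ (N + M) / N * (x * x) + (N + M) / M * (y * y) := by
  have h : (N + M) / N * (x * x) + (N + M) / M * (y * y) - (x + y) * (x + y) =
      (M * x - N * y) ^ 2 / (N * M) := by
    field_simp
    ring
  have : 0 ≤ (M * x - N * y) ^ 2 / (N * M) := by positivity
  linarith

/-- The trace inequality, with the constant written in terms of the height `c`. -/
theorem face_integral_le (T : Tetrahedron) {σ : Measure (EuclideanSpace ℝ (Fin 3))} {c : ℝ}
    (hc : 0 < c) (hint : ∀ f : EuclideanSpace ℝ (Fin 3) → ℝ, Continuous f → Integrable f σ)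
    (hσ : ∀ (m : ℤ) (P : MvPolynomial (Fin 3) ℝ), P ∈ polySpace m →
        (∀ Q ∈ polySpace (m - 1), l2Form T P Q = 0) →
        c * ∫ x, polyFun P x * polyFun P x ∂σ = (2 * m + 3) * l2Form T P P)
    {n : ℤ} (hn : -1 ≤ n) (k : ℕ) (P : MvPolynomial (Fin 3) ℝ) (hP : P ∈ polySpace (n + k))
    (horth : ∀ Q ∈ polySpace n, l2Form T P Q = 0) :
    c * ∫ x, polyFun P x * polyFun P x ∂σ ≤ k * (2 * n + k + 4) * l2Form T P P := by
  induction k generalizing P with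
  | zero =>
    rw [eq_zero_of_mem_of_orthogonal T (by simpa using hP) horth]
    simp [polyFun]
  | succ k ih =>
    have hn' : (-1 : ℝ) ≤ n := by exact_mod_cast hn
    -- The first degree is separate: the accumulated weight `N` would be zero there, and the
    -- weighted inequality divides by it.
    rcases Nat.eq_zero_or_pos k with rfl | hk
    · rw [hσ (n + 1) P (by simpa using hP) (by simpa using horth)]
      apply le_of_eq
      push_cast
      ring
    -- `R` collects the degrees up to `n + k`, and `P - R` is the component of degree `n + k + 1`.
    · obtain ⟨R, ⟨hR, hPR⟩, -⟩ := existsUnique_isL2Projection T (n + k) P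
      replace hPR := ((isL2Projection_iff T (n + k) P R).1 ⟨hR, hPR⟩).2
      have hS : P - R ∈ polySpace (n + k + 1) :=
        Submodule.sub_mem _ (by simpa [add_assoc] using hP) (polySpace_mono (by omega) hR)
      have h1 := ih R hR fun Q hQ => by
        have h := hPR Q (polySpace_mono (by omega) hQ)
        rw [map_sub, LinearMap.sub_apply, horth Q hQ] at h
        linarith
      have h2 := hσ _ (P - R) hS (by simpa using hPR)
      have hpyth : l2Form T P P = l2Form T R R + l2Form T (P - R) (P - R) := by
        have h := hPR R hR
        have hcomm := l2Form_comm T P R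
        simp only [map_sub, LinearMap.sub_apply] at h ⊢
        linarith
      have hk' : (1 : ℝ) ≤ k := by exact_mod_cast hk
      -- `N` is the sum of the weights `2m + 3` used so far, `M` the new one.
      set N : ℝ := k * (2 * n + k + 4) with hNdef
      set M : ℝ := 2 * ((n + k + 1 : ℤ) : ℝ) + 3 with hMdef
      have hN : 0 < N := by
        rw [hNdef]
        apply mul_pos <;> linarith
      have hM : 0 < M := by
        rw [hMdef]
        push_cast
        linarith
      have hNM : ((k + 1 : ℕ) : ℝ) * (2 * n + (k + 1 : ℕ) + 4) = N + M := by
        rw [hNdef, hMdef]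
        push_cast
        ring
      have hi (Q : MvPolynomial (Fin 3) ℝ) : Integrable (fun x => polyFun Q x * polyFun Q x) σ :=
        hint _ ((continuous_polyFun Q).mul (continuous_polyFun Q))
      have h3 : ∫ x, polyFun P x * polyFun P x ∂σ ≤
          (N + M) / N * ∫ x, polyFun R x * polyFun R x ∂σ +
            (N + M) / M * ∫ x, polyFun (P - R) x * polyFun (P - R) x ∂σ := by
        rw [← integral_const_mul, ← integral_const_mul,
          ← integral_add ((hi R).const_mul _) ((hi (P - R)).const_mul _)]
        refine integral_mono (hi P) (((hi R).const_mul _).add ((hi (P - R)).const_mul _))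
          fun x => ?_
        have : polyFun P x = polyFun R x + polyFun (P - R) x := by simp [polyFun]
        simp only [this]
        exact add_mul_self_le_of_pos hN hM
      rw [hNM, hpyth]
      calc c * ∫ x, polyFun P x * polyFun P x ∂σ
          ≤ c * ((N + M) / N * ∫ x, polyFun R x * polyFun R x ∂σ +
            (N + M) / M * ∫ x, polyFun (P - R) x * polyFun (P - R) x ∂σ) :=
            mul_le_mul_of_nonneg_left h3 hc.le
        _ = (N + M) / N * (c * ∫ x, polyFun R x * polyFun R x ∂σ) +
            (N + M) / M * (c * ∫ x, polyFun (P - R) x * polyFun (P - R) x ∂σ) := by ring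
        _ ≤ (N + M) / N * (N * l2Form T R R) + (N + M) / M * (M * l2Form T (P - R) (P - R)) := by
            rw [h2]
            gcongr
        _ = (N + M) * (l2Form T R R + l2Form T (P - R) (P - R)) := by
            field_simp

/-! ### Passage to `eLpNorm` and conclusion -/

theorem eLpNorm_two_sq_eq_ofReal {α : Type*} [MeasurableSpace α] {μ : Measure α} {f : α → ℝ}
    (hf : Integrable (fun x => f x * f x) μ) :
    eLpNorm f 2 μ ^ 2 = ENNReal.ofReal (∫ x, f x * f x ∂μ) := by
  have h := eLpNorm_nnreal_pow_eq_lintegral (f := f) (μ := μ) (p := 2) two_ne_zero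
  rw [ofReal_integral_eq_lintegral_ofReal hf (Filter.Eventually.of_forall fun _ =>
    mul_self_nonneg _)]
  norm_num at h
  rw [h]
  refine lintegral_congr fun x => ?_
  rw [← sq, ← sq_abs, ENNReal.ofReal_pow (abs_nonneg _), ← Real.norm_eq_abs, ofReal_norm]

theorem mainTheorem4 (T : Tetrahedron) (i : Fin 4) (p : ℕ) (n : ℤ) (hn : -1 ≤ n) (hnp : n ≤ p)
    (ξ θ : MvPolynomial (Fin 3) ℝ) (hξ : ξ ∈ polySpace p) (hθ : θ = ξ - l2Projection T n ξ) :
    eLpNorm (polyFun θ) 2 ((μHE[2]).restrict (T.faceOpposite i).closedInterior) ^ 2 ≤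
      ENNReal.ofReal (((p : ℝ) - n) * (p + n + 4) / 3) *
        (μHE[2] (T.faceOpposite i).closedInterior / volume T.closedInterior) *
        eLpNorm (polyFun θ) 2 (volume.restrict T.closedInterior) ^ 2 := by
  obtain ⟨c, hc, hfin, hvol, hint, hσ⟩ := exists_height T i
  obtain ⟨hη, horth⟩ := (isL2Projection_iff T n ξ _).1 (l2Projection_spec T n ξ)
  rw [← hθ] at horth
  obtain ⟨k, hk⟩ := Int.le.dest hnp
  have hθp : θ ∈ polySpace (n + k) := by
    rw [hθ, hk]
    exact Submodule.sub_mem _ hξ (polySpace_mono hnp hη)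
  have hmain := face_integral_le T hc hint hσ hn k θ hθp horth
  have hkr : (k : ℝ) = p - n := by
    rw [eq_sub_iff_add_eq']
    exact_mod_cast hk
  have hTfin : volume T.closedInterior ≠ ⊤ := (isCompact_tetrahedron T).measure_ne_top
  have ht : 0 < volume.real T.closedInterior :=
    ENNReal.toReal_pos (Measure.measure_pos_of_nonempty_interior _
      (nonempty_interior_tetrahedron T)).ne' hTfin
  have hFσ : μHE[2] (T.faceOpposite i).closedInterior = faceMeasure T i Set.univ := by
    rw [faceMeasure, Measure.restrict_apply_univ]
  have hcont := (continuous_polyFun θ).mul (continuous_polyFun θ)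
  have hn' : (-1 : ℝ) ≤ n := by exact_mod_cast hn
  have hk0 : (0 : ℝ) ≤ k := Nat.cast_nonneg k
  have hN : 0 ≤ ((p : ℝ) - n) * (p + n + 4) / 3 := by
    rw [← hkr]
    have : (0 : ℝ) ≤ p := Nat.cast_nonneg p
    have : (0 : ℝ) ≤ p + n + 4 := by linarith
    positivity
  rw [← faceMeasure, eLpNorm_two_sq_eq_ofReal (hint _ hcont),
    eLpNorm_two_sq_eq_ofReal (integrableOn_polyFun_mul T θ θ), ← l2Form_apply, hFσ,
    ← ofReal_measureReal, ← ofReal_measureReal hTfin, ← ENNReal.ofReal_div_of_pos ht,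
    ← ENNReal.ofReal_mul hN, ← ENNReal.ofReal_mul (by positivity)]
  apply ENNReal.ofReal_le_ofReal
  have hratio : (faceMeasure T i).real Set.univ / volume.real T.closedInterior = 3 / c := by
    rw [div_eq_div_iff ht.ne' hc.ne', hvol, mul_comm]
  have hconst : (k : ℝ) * (2 * n + k + 4) = (p - n) * (p + n + 4) := by
    rw [hkr]
    ring
  rw [hratio, ← mul_le_mul_iff_right₀ hc]
  refine hmain.trans (le_of_eq ?_)
  rw [hconst]
  field_simp
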